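/- All Hilbert spaces are complex. A \emph{P-module} is a triple $(A,B,\mathfrak H)$ where $\mathfrak H$ is a Hilbert space and $A,B\in B(\mathfrak H)$ satisfy $A^*A+B^*B=\mathrm{id}$. A \emph{sub-module} is a closed subspace stable under $A$ and $B$. A sub-module $\mathfrak H_0$ is \emph{complete} if $\mathfrak H_0^\perp$ contains no nonzero sub-module; the P-module is \emph{full} if $\mathfrak H_0^\perp=\{0\}$ for every complete sub-module $\mathfrak H_0$, and \emph{irreducible} if it is nonzero and has no sub-module other than $\{0\}$ and itself. It is \emph{diffuse} if $x_n\cdots x_2x_1\xi\to 0$ for every $\xi\in\mathfrak H$ and every sequence $(x_n)_{n\ge1}$ in $\{A,B\}$. Given a P-module $(A,B,\mathfrak H)$, let $\mathscr H$ be the Hilbert space completion of the direct limit, over all finite rooted binary trees $t$, of the Hilbert spaces $\mathfrak H_t$ of maps from the leaves of $t$ to $\mathfrak H$ with inner product $\langle\xi,\eta\rangle=\sum_{\ell}\langle\xi_\ell,\eta_\ell\rangle$; the connecting isometries replace, when a caret is attached at a leaf decorated by $\xi$, this decoration with $A\xi$ on the left new leaf and $B\xi$ on the right new leaf. The space $\mathfrak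 H$ is identified with $\mathfrak H_t\subset\mathscr H$ for the trivial tree $t$. Let $\tau_0$ (resp. $\tau_1$) be the operator on $\mathscr H$ that sends a decorated tree, once grown to have at least two leaves, to its left (resp. right) decorated subtree below the root. The \emph{associated representation} $\sigma$ of the Cuntz algebra $\mathcal O=C^*\langle s_0,s_1\mid s_0s_0^*+s_1s_1^*=s_0^*s_0=s_1^*s_1=1\rangle$ on $\mathscr H$ is $s_i\mapsto S_i:=\tau_i^*$, $i=0,1$. The \emph{Pythagorean dimension} $\dim_P$ of a representation of $\mathcal O$ is the minimum in $\mathbf N\cup\{\infty\}$ of the dimensions of all P-modules whose associated representation of $\mathcal O$ is unitarily equivalent to it ($\infty$ if there is no finite dimensional one). \textbf{Theorem.} Let $(A,B,\mathfrak H)$ be a finite dimensional P-module with associated representation $\sigma:\mathcal O\curvearrowright\mathscr H$, $s_i\mapsto S_i$. Then $(S_0^*,S_1^*,\mathscr H)$ is a P-module containing $(A,B,\mathfrak H)$ as a sub-module. Let $\mathcal M$ be the set of all complete sub-modules of $(S_0^*,S_1^*,\mathscr H)$. \begin{enumerate} \item The set $\mathcal M$ has a smallest element $\mathfrak H_{\rm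 small}$ for inclusion: the intersection $\mathfrak H_{\rm small}$ of all elements of $\mathcal M$ is in $\mathcal M$. Moreover $\mathfrak H_{\rm small}\subset\mathfrak H$. \item $\dim_P(\mathscr H)=\dim(\mathfrak H_{\rm small})$. \item If $(A,B,\mathfrak H)$ is full, then $\mathfrak H=\mathfrak H_{\rm small}$ and $\dim_P(\mathscr H)=\dim(\mathfrak H)$. \item If $(A,B,\mathfrak H)$ is diffuse and $\sigma$ is irreducible, then $\mathfrak H_{\rm small}$ is the unique smallest nontrivial sub-module of $\mathscr H$: it is nonzero and contained in every nonzero sub-module of $(S_0^*,S_1^*,\mathscr H)$. If in addition $(A,B,\mathfrak H)$ is an irreducible P-module, then $\mathfrak H=\mathfrak H_{\rm small}$. \end{enumerate} -/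

import Mathlib

noncomputable section

/-- A Pythagorean module `(A, B, H)`: bounded operators with `A* A + B* B = 1`. -/
structure PModule (H : Type*) [NormedAddCommGroup H] [InnerProductSpace ℂ H]
    [CompleteSpace H] where
  A : H →L[ℂ] H
  B : H →L[ℂ] H
  pythagorean : A.adjoint ∘L A + B.adjoint ∘L B = ContinuousLinearMap.id ℂ H

/-- Finite rooted binary trees; `leaf` is the trivial tree with one leaf. -/
inductive BTree : Type
  | leaf : BTree
  | node (l r : BTree) : BTree

namespace BTree

/-- The set of leaves of a tree. -/
def Leaf : BTree → Type
  | leaf => Unit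
  | node l r => Leaf l ⊕ Leaf r

instance Leaf.fintype : ∀ t : BTree, Fintype (Leaf t)
  | leaf => inferInstanceAs (Fintype Unit)
  | node l r =>
    letI := Leaf.fintype l
    letI := Leaf.fintype r
    inferInstanceAs (Fintype (Leaf l ⊕ Leaf r))

/-- `t ≤ s` when `t` is a rooted subtree of `s`. -/
def IsSubtree : BTree → BTree → Prop
  | leaf, _ => True
  | node _ _, leaf => False
  | node l r, node l' r' => IsSubtree l l' ∧ IsSubtree r r'

theorem IsSubtree.refl : ∀ t, IsSubtree t t
  | leaf => trivial
  | node l r => ⟨IsSubtree.refl l, IsSubtree.refl r⟩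

theorem IsSubtree.trans : ∀ {t s u}, IsSubtree t s → IsSubtree s u → IsSubtree t u
  | leaf, _, _, _, _ => trivial
  | node _ _, leaf, _, h, _ => h.elim
  | node _ _, node _ _, leaf, _, h => h.elim
  | node _ _, node _ _, node _ _, h, k => ⟨h.1.trans k.1, h.2.trans k.2⟩

instance : Preorder BTree where
  le := IsSubtree
  le_refl := IsSubtree.refl
  le_trans _ _ _ := IsSubtree.trans

/-- The union of two trees. -/
def sup : BTree → BTree → BTree
  | leaf, s => s
  | node l r, leaf => node l r
  | node l r, node l' r' => node (sup l l') (sup r r')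

theorem le_sup_left : ∀ t s : BTree, t ≤ sup t s
  | leaf, _ => trivial
  | node l r, leaf => IsSubtree.refl (node l r)
  | node l r, node l' r' => ⟨le_sup_left l l', le_sup_left r r'⟩

theorem le_sup_right : ∀ t s : BTree, s ≤ sup t s
  | leaf, s => IsSubtree.refl s
  | node _ _, leaf => trivial
  | node l r, node l' r' => ⟨le_sup_right l l', le_sup_right r r'⟩

instance : IsDirectedOrder BTree :=
  ⟨fun t s => ⟨sup t s, le_sup_left t s, le_sup_right t s⟩⟩

instance : Nonempty BTree := ⟨leaf⟩

end BTree

namespace PModule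

open BTree

section Construction

section LeafInner

variable {H : Type*} [NormedAddCommGroup H] [InnerProductSpace ℂ H]

/-- The inner product on decorations of the leaves of a tree. -/
def leafInner (t : BTree) (ξ η : Leaf t → H) : ℂ := ∑ i, inner ℂ (ξ i) (η i)

theorem leafInner_leaf (ξ η : Leaf leaf → H) :
    leafInner leaf ξ η = inner ℂ (ξ ()) (η ()) :=
  Fintype.sum_unique (ι := Unit) _

theorem leafInner_node (l r : BTree) (ξ η : Leaf (node l r) → H) :
    leafInner (node l r) ξ η =
      leafInner l (fun i => ξ (Sum.inl i)) (fun i => η (Sum.inl i)) +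
      leafInner r (fun i => ξ (Sum.inr i)) (fun i => η (Sum.inr i)) :=
  Fintype.sum_sum_type (α₁ := Leaf l) (α₂ := Leaf r) _

end LeafInner

variable {H : Type*} [NormedAddCommGroup H] [InnerProductSpace ℂ H] [CompleteSpace H]
  (m : PModule H)

/-- The operator attached to a binary digit: `A` for `0` and `B` for `1`. -/
def op : Bool → H →L[ℂ] H
  | false => m.A
  | true => m.B

/-- The connecting map on decorations of leaves: at every caret that has to be added to
`t` in order to reach `s`, a decoration `ξ` is replaced with `A ξ` on the left leg and with
`B ξ` on the right leg. It is used for `t ≤ s` only (the second clause never occurs then). -/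
def growFun : ∀ t s : BTree, (Leaf t → H) → (Leaf s → H)
  | leaf, leaf, ξ => ξ
  | node _ _, leaf, _ => 0
  | leaf, node l r, ξ => Sum.elim (growFun leaf l fun u => m.A (ξ u))
      (growFun leaf r fun u => m.B (ξ u))
  | node l r, node l' r', ξ => Sum.elim (growFun l l' fun i => ξ (Sum.inl i))
      (growFun r r' fun i => ξ (Sum.inr i))

theorem growFun_add : ∀ (t s : BTree) (ξ η : Leaf t → H),
    m.growFun t s (ξ + η) = m.growFun t s ξ + m.growFun t s η
  | leaf, leaf, _, _ => rfl
  | node _ _, leaf, _, _ => (add_zero _).symm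
  | leaf, node l r, ξ, η => by
    have h1 := growFun_add leaf l (fun u => m.A (ξ u)) (fun u => m.A (η u))
    have h2 := growFun_add leaf r (fun u => m.B (ξ u)) (fun u => m.B (η u))
    funext i
    rcases i with i | i
    · have e : (fun u => m.A ((ξ + η) u)) = (fun u => m.A (ξ u)) + fun u => m.A (η u) := by
        funext u; simp
      exact (congrFun (congrArg (m.growFun leaf l) e) i).trans (congrFun h1 i)
    · have e : (fun u => m.B ((ξ + η) u)) = (fun u => m.B (ξ u)) + fun u => m.B (η u) := by
        funext u; simp
      exact (congrFun (congrArg (m.growFun leaf r) e) i).trans (congrFun h2 i)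
  | node l r, node l' r', ξ, η => by
    have h1 := growFun_add l l' (fun i => ξ (Sum.inl i)) (fun i => η (Sum.inl i))
    have h2 := growFun_add r r' (fun i => ξ (Sum.inr i)) (fun i => η (Sum.inr i))
    funext i
    rcases i with i | i
    · exact congrFun h1 i
    · exact congrFun h2 i

theorem growFun_smul : ∀ (t s : BTree) (c : ℂ) (ξ : Leaf t → H),
    m.growFun t s (c • ξ) = c • m.growFun t s ξ
  | leaf, leaf, _, _ => rfl
  | node _ _, leaf, _, _ => (smul_zero _).symm
  | leaf, node l r, c, ξ => by
    have h1 := growFun_smul leaf l c (fun u => m.A (ξ u))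
    have h2 := growFun_smul leaf r c (fun u => m.B (ξ u))
    funext i
    rcases i with i | i
    · have e : (fun u => m.A ((c • ξ) u)) = c • fun u => m.A (ξ u) := by
        funext u; simp
      exact (congrFun (congrArg (m.growFun leaf l) e) i).trans (congrFun h1 i)
    · have e : (fun u => m.B ((c • ξ) u)) = c • fun u => m.B (ξ u) := by
        funext u; simp
      exact (congrFun (congrArg (m.growFun leaf r) e) i).trans (congrFun h2 i)
  | node l r, node l' r', c, ξ => by
    have h1 := growFun_smul l l' c (fun i => ξ (Sum.inl i))
    have h2 := growFun_smul r r' c (fun i => ξ (Sum.inr i))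
    funext i
    rcases i with i | i
    · exact congrFun h1 i
    · exact congrFun h2 i

theorem growFun_self : ∀ (t : BTree) (ξ : Leaf t → H), m.growFun t t ξ = ξ
  | leaf, _ => rfl
  | node l r, ξ => by
    funext i
    rcases i with i | i
    · exact congrFun (growFun_self l _) i
    · exact congrFun (growFun_self r _) i

theorem growFun_growFun : ∀ (t s u : BTree), t ≤ s → s ≤ u → ∀ ξ : Leaf t → H,
    m.growFun s u (m.growFun t s ξ) = m.growFun t u ξ
  | leaf, leaf, _, _, _, _ => rfl
  | node _ _, leaf, _, h, _, _ => h.elim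
  | _, node _ _, leaf, _, h, _ => h.elim
  | leaf, node l r, node l' r', _, h, ξ => by
    funext i
    rcases i with i | i
    · exact congrFun (growFun_growFun leaf l l' trivial h.1 _) i
    · exact congrFun (growFun_growFun leaf r r' trivial h.2 _) i
  | node l r, node l' r', node l'' r'', h, k, ξ => by
    funext i
    rcases i with i | i
    · exact congrFun (growFun_growFun l l' l'' h.1 k.1 _) i
    · exact congrFun (growFun_growFun r r' r'' h.2 k.2 _) i

theorem inner_A_add_inner_B (x y : H) :
    inner ℂ (m.A x) (m.A y) + inner ℂ (m.B x) (m.B y) = inner ℂ x y := by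
  have h := congrArg (fun T : H →L[ℂ] H => inner ℂ x (T y)) m.pythagorean
  simpa [inner_add_right, ContinuousLinearMap.adjoint_inner_right] using h

theorem leafInner_growFun : ∀ (t s : BTree), t ≤ s → ∀ ξ η : Leaf t → H,
    leafInner s (m.growFun t s ξ) (m.growFun t s η) = leafInner t ξ η
  | leaf, leaf, _, _, _ => rfl
  | node _ _, leaf, h, _, _ => h.elim
  | leaf, node l r, _, ξ, η => by
    rw [leafInner_node, leafInner_leaf, ← m.inner_A_add_inner_B]
    have h1 := leafInner_growFun leaf l trivial (fun u => m.A (ξ u)) (fun u => m.A (η u))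
    have h2 := leafInner_growFun leaf r trivial (fun u => m.B (ξ u)) (fun u => m.B (η u))
    rw [leafInner_leaf] at h1 h2
    rw [← h1, ← h2]
    rfl
  | node l r, node l' r', h, ξ, η => by
    rw [leafInner_node, leafInner_node, ← leafInner_growFun l l' h.1,
      ← leafInner_growFun r r' h.2]
    rfl

/-- The connecting maps as linear maps. -/
def grow (t s : BTree) (_ : t ≤ s) : (Leaf t → H) →ₗ[ℂ] (Leaf s → H) where
  toFun := m.growFun t s
  map_add' := m.growFun_add t s
  map_smul' := m.growFun_smul t s

instance directedSystem : DirectedSystem (fun t : BTree => Leaf t → H) (m.grow · · ·) where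
  map_self t ξ := m.growFun_self t ξ
  map_map _ _ _ h k ξ := m.growFun_growFun _ _ _ h k ξ

/-- The pre-Hilbert space of decorated trees: the direct limit, over all trees `t`, of the
spaces of maps from the leaves of `t` to `H`. -/
def Pre : Type _ := DirectLimit (fun t : BTree => Leaf t → H) m.grow

instance : AddCommGroup m.Pre :=
  inferInstanceAs (AddCommGroup (DirectLimit (fun t : BTree => Leaf t → H) m.grow))

instance : Module ℂ m.Pre :=
  inferInstanceAs (Module ℂ (DirectLimit (fun t : BTree => Leaf t → H) m.grow))

/-- The class `[t, ξ]` of a tree with decorated leaves. -/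
def cls (t : BTree) (ξ : Leaf t → H) : m.Pre :=
  (⟦⟨t, ξ⟩⟧ : DirectLimit (fun t : BTree => Leaf t → H) m.grow)

theorem cls_growFun {t s : BTree} (h : t ≤ s) (ξ : Leaf t → H) :
    m.cls s (m.growFun t s ξ) = m.cls t ξ :=
  DirectLimit.mk_apply (F := fun t : BTree => Leaf t → H) (f := m.grow) t s ξ h

theorem cls_add (t : BTree) (ξ η : Leaf t → H) : m.cls t (ξ + η) = m.cls t ξ + m.cls t η :=
  (DirectLimit.add_def (G := fun t : BTree => Leaf t → H) (f := m.grow) t ξ η).symm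

theorem cls_smul (t : BTree) (c : ℂ) (ξ : Leaf t → H) : m.cls t (c • ξ) = c • m.cls t ξ :=
  (DirectLimit.smul_def (G := fun t : BTree => Leaf t → H) (f := m.grow) t ξ c).symm

theorem cls_zero (t : BTree) : m.cls t 0 = 0 :=
  (DirectLimit.zero_def (f := m.grow) t).symm

theorem ind {C : m.Pre → Prop} (h : ∀ t ξ, C (m.cls t ξ)) (x : m.Pre) : C x :=
  DirectLimit.induction m.grow h x

theorem ind₂ {C : m.Pre → m.Pre → Prop} (h : ∀ t ξ η, C (m.cls t ξ) (m.cls t η))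
    (x y : m.Pre) : C x y :=
  DirectLimit.induction₂ m.grow h x y

theorem ind₃ {C : m.Pre → m.Pre → m.Pre → Prop}
    (h : ∀ t ξ η ζ, C (m.cls t ξ) (m.cls t η) (m.cls t ζ)) (x y z : m.Pre) : C x y z :=
  DirectLimit.induction₃ m.grow h x y z

/-- The inner product of the direct limit. -/
def preInner (x y : m.Pre) : ℂ :=
  DirectLimit.lift₂ m.grow m.grow (fun t ξ η => leafInner t ξ η)
    (fun t s h ξ η => (m.leafInner_growFun t s h ξ η).symm) x y

theorem preInner_cls (t : BTree) (ξ η : Leaf t → H) :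
    m.preInner (m.cls t ξ) (m.cls t η) = leafInner t ξ η :=
  DirectLimit.lift₂_def (F₁ := fun t : BTree => Leaf t → H) (F₂ := fun t : BTree => Leaf t → H)
    m.grow m.grow _ _ t ξ η

instance preCore : InnerProductSpace.Core ℂ m.Pre where
  inner := m.preInner
  conj_inner_symm := m.ind₂ fun t ξ η => by
    simp only [preInner_cls, leafInner, map_sum, inner_conj_symm]
  re_inner_nonneg := m.ind fun t ξ => by
    simp only [preInner_cls, leafInner, map_sum]
    exact Finset.sum_nonneg fun i _ => inner_self_nonneg
  add_left := m.ind₃ fun t ξ η ζ => by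
    simp only [← cls_add, preInner_cls, leafInner, Pi.add_apply, inner_add_left,
      Finset.sum_add_distrib]
  smul_left x y c := by
    refine m.ind₂ (C := fun x y => m.preInner (c • x) y = starRingEnd ℂ c * m.preInner x y)
      (fun t ξ η => ?_) x y
    simp only [← cls_smul, preInner_cls, leafInner, Pi.smul_apply, inner_smul_left,
      Finset.mul_sum]
  definite := m.ind fun t ξ h => by
    have h' : (∑ i, inner ℂ (ξ i) (ξ i)) = 0 := (m.preInner_cls t ξ ξ).symm.trans h
    have h0 : ∑ i, ‖ξ i‖ ^ 2 = 0 := by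
      have := congrArg Complex.re h'
      simp only [Complex.re_sum] at this
      rw [Complex.zero_re] at this
      rw [← this]
      exact Finset.sum_congr rfl fun i _ => (inner_self_eq_norm_sq (𝕜 := ℂ) (ξ i)).symm
    have hξ : ξ = 0 := by
      funext i
      have := (Finset.sum_eq_zero_iff_of_nonneg (fun i _ => sq_nonneg ‖ξ i‖)).1 h0 i
        (Finset.mem_univ i)
      simpa using this
    rw [hξ, cls_zero]

instance : NormedAddCommGroup m.Pre := m.preCore.toNormedAddCommGroup

instance : InnerProductSpace ℂ m.Pre := InnerProductSpace.ofCore m.preCore.toCore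

theorem inner_cls (t : BTree) (ξ η : Leaf t → H) :
    inner ℂ (m.cls t ξ) (m.cls t η) = leafInner t ξ η :=
  m.preInner_cls t ξ η

/-- The Hilbert space completion of the space of decorated trees. -/
abbrev BigSpace : Type _ := UniformSpace.Completion m.Pre

/-- The copy of `H` in the large Hilbert space: decorations of the trivial tree. -/
def preEmbed : H →ₗᵢ[ℂ] m.Pre where
  toFun x := m.cls leaf fun _ => x
  map_add' x y := m.cls_add leaf (fun _ => x) (fun _ => y)
  map_smul' c x := m.cls_smul leaf c (fun _ => x)
  norm_map' x := by
    have h : inner ℂ (m.cls leaf fun _ => x) (m.cls leaf fun _ => x) = inner ℂ x x := by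
      rw [inner_cls, leafInner_leaf]
    rw [inner_self_eq_norm_sq_to_K, inner_self_eq_norm_sq_to_K] at h
    have h2 : ‖m.cls leaf fun _ => x‖ ^ 2 = ‖x‖ ^ 2 := by exact_mod_cast h
    exact (sq_eq_sq₀ (norm_nonneg _) (norm_nonneg _)).1 h2

/-- The embedding of `H` into the large Hilbert space. -/
def embed : H →ₗᵢ[ℂ] m.BigSpace :=
  (UniformSpace.Completion.toComplₗᵢ (𝕜 := ℂ) (E := m.Pre)).comp m.preEmbed

/-- Snip a decorated tree at the vertex `0` (for `false`) or `1` (for `true`) and keep the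
subtree with that root; the trivial tree with decoration `ξ` is first grown to the tree with
two leaves, which are decorated by `A ξ` and `B ξ`. -/
def snipFun : Bool → ∀ t : BTree, (Leaf t → H) → m.Pre
  | i, leaf, ξ => m.cls leaf fun u => m.op i (ξ u)
  | false, node l _, ξ => m.cls l fun i => ξ (Sum.inl i)
  | true, node _ r, ξ => m.cls r fun i => ξ (Sum.inr i)

theorem snipFun_growFun : ∀ (i : Bool) (t s : BTree), t ≤ s → ∀ ξ : Leaf t → H,
    m.snipFun i t ξ = m.snipFun i s (m.growFun t s ξ)
  | _, leaf, leaf, _, _ => rfl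
  | _, node _ _, leaf, h, _ => h.elim
  | false, leaf, node _ _, _, _ => (m.cls_growFun (t := leaf) trivial _).symm
  | true, leaf, node _ _, _, _ => (m.cls_growFun (t := leaf) trivial _).symm
  | false, node _ _, node _ _, h, _ => (m.cls_growFun h.1 _).symm
  | true, node _ _, node _ _, h, _ => (m.cls_growFun h.2 _).symm

/-- Snipping on classes of decorated trees. -/
def snip (i : Bool) (x : m.Pre) : m.Pre :=
  DirectLimit.lift m.grow (m.snipFun i) (m.snipFun_growFun i) x

theorem snip_cls (i : Bool) (t : BTree) (ξ : Leaf t → H) :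
    m.snip i (m.cls t ξ) = m.snipFun i t ξ := rfl

theorem snip_add (i : Bool) : ∀ x y, m.snip i (x + y) = m.snip i x + m.snip i y := by
  refine m.ind₂ fun t ξ η => ?_
  rw [← cls_add, snip_cls, snip_cls, snip_cls]
  rcases i with _ | _ <;> rcases t with _ | ⟨l, r⟩ <;> simp only [snipFun, ← cls_add] <;>
    congr 1 <;> funext u <;> simp

theorem snip_smul (i : Bool) (c : ℂ) : ∀ x, m.snip i (c • x) = c • m.snip i x := by
  refine m.ind fun t ξ => ?_
  rw [← cls_smul, snip_cls, snip_cls]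
  rcases i with _ | _ <;> rcases t with _ | ⟨l, r⟩ <;> simp only [snipFun, ← cls_smul] <;>
    congr 1 <;> funext u <;> simp

theorem inner_snip : ∀ x y, inner ℂ (m.snip false x) (m.snip false y) +
    inner ℂ (m.snip true x) (m.snip true y) = inner ℂ x y := by
  refine m.ind₂ fun t ξ η => ?_
  simp only [snip_cls]
  rcases t with _ | ⟨l, r⟩
  · simp only [snipFun, inner_cls, leafInner_leaf, op]
    exact m.inner_A_add_inner_B _ _
  · simp only [snipFun, inner_cls, leafInner_node]

theorem norm_snip_le (i : Bool) (x : m.Pre) : ‖m.snip i x‖ ≤ 1 * ‖x‖ := by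
  have h := m.inner_snip x x
  simp only [inner_self_eq_norm_sq_to_K] at h
  have h2 : ‖m.snip false x‖ ^ 2 + ‖m.snip true x‖ ^ 2 = ‖x‖ ^ 2 := by exact_mod_cast h
  rw [one_mul]
  refine (sq_le_sq₀ (norm_nonneg _) (norm_nonneg _)).1 ?_
  rcases i with _ | _
  · nlinarith [sq_nonneg ‖m.snip true x‖]
  · nlinarith [sq_nonneg ‖m.snip false x‖]

/-- Snipping as a bounded operator on the pre-Hilbert space. -/
def preTau (i : Bool) : m.Pre →L[ℂ] m.Pre :=
  LinearMap.mkContinuous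
    { toFun := m.snip i, map_add' := m.snip_add i, map_smul' := m.snip_smul i } 1
    (m.norm_snip_le i)

/-- The partial isometry `τ_i` of the large Hilbert space: the continuous extension of the
snipping map. -/
def tau (i : Bool) : m.BigSpace →L[ℂ] m.BigSpace :=
  ((UniformSpace.Completion.toComplL (𝕜 := ℂ) (E := m.Pre)) ∘L m.preTau i).extend
    (UniformSpace.Completion.toComplL (𝕜 := ℂ) (E := m.Pre))

theorem tau_coe (i : Bool) (x : m.Pre) :
    m.tau i (x : m.BigSpace) = ((m.snip i x : m.Pre) : m.BigSpace) :=
  ContinuousLinearMap.extend_eq _ UniformSpace.Completion.denseRange_coe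
    (UniformSpace.Completion.isUniformInducing_coe _) x

theorem tau_embed (i : Bool) (x : H) : m.tau i (m.embed x) = m.embed (m.op i x) :=
  m.tau_coe i (m.cls leaf fun _ => x)

theorem adjoint_tau_add :
    (m.tau false).adjoint ∘L m.tau false + (m.tau true).adjoint ∘L m.tau true =
      ContinuousLinearMap.id ℂ m.BigSpace := by
  refine ContinuousLinearMap.ext fun x => ext_inner_right ℂ fun y => ?_
  simp only [add_apply, ContinuousLinearMap.comp_apply, inner_add_left,
    ContinuousLinearMap.adjoint_inner_left, ContinuousLinearMap.id_apply]
  refine UniformSpace.Completion.induction_on₂ x y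
    (isClosed_eq (by fun_prop) (by fun_prop)) fun a b => ?_
  simp only [tau_coe, UniformSpace.Completion.inner_coe]
  exact m.inner_snip a b

/-- Attach a decorated tree at the vertex `0` or `1` and decorate the other leaf by zero. -/
def plant (i : Bool) : m.Pre → m.Pre :=
  DirectLimit.lift m.grow
    (fun t ξ => match i with
      | false => m.cls (node t leaf) (Sum.elim ξ 0)
      | true => m.cls (node leaf t) (Sum.elim 0 ξ))
    (fun t s h ξ => by
      rcases i with _ | _
      · exact (m.cls_growFun (t := node t leaf) (s := node s leaf) ⟨h, trivial⟩ _).symm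
      · exact (m.cls_growFun (t := node leaf t) (s := node leaf s) ⟨trivial, h⟩ _).symm)

theorem snip_plant (i j : Bool) : ∀ x, m.snip i (m.plant j x) = if i = j then x else 0 := by
  refine m.ind fun t ξ => ?_
  rcases i with _ | _ <;> rcases j with _ | _
  · rfl
  · exact m.cls_zero leaf
  · exact m.cls_zero leaf
  · rfl

theorem adjoint_tau_coe (i : Bool) (x : m.Pre) :
    (m.tau i).adjoint (x : m.BigSpace) = ((m.plant i x : m.Pre) : m.BigSpace) := by
  have h := congrArg (fun T : m.BigSpace →L[ℂ] m.BigSpace => T (m.plant i x : m.Pre))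
    m.adjoint_tau_add
  simp only [add_apply, ContinuousLinearMap.comp_apply, tau_coe,
    snip_plant, ContinuousLinearMap.id_apply] at h
  rw [← h]
  rcases i with _ | _ <;> simp [UniformSpace.Completion.coe_zero]

theorem tau_adjoint_tau (i j : Bool) :
    m.tau i ∘L (m.tau j).adjoint = if i = j then ContinuousLinearMap.id ℂ m.BigSpace else 0 := by
  refine ContinuousLinearMap.ext fun x => ?_
  refine UniformSpace.Completion.induction_on x
    (isClosed_eq (by fun_prop) (by fun_prop)) fun a => ?_
  rw [ContinuousLinearMap.comp_apply, adjoint_tau_coe, tau_coe, snip_plant]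
  split_ifs <;> simp

end Construction

end PModule

/-- A representation of the Cuntz algebra on a Hilbert space, given by the images of the
two generating isometries. -/
structure CuntzRep (K : Type*) [NormedAddCommGroup K] [InnerProductSpace ℂ K]
    [CompleteSpace K] where
  S₀ : K →L[ℂ] K
  S₁ : K →L[ℂ] K
  isometry₀ : S₀.adjoint ∘L S₀ = ContinuousLinearMap.id ℂ K
  isometry₁ : S₁.adjoint ∘L S₁ = ContinuousLinearMap.id ℂ K
  sum_ranges : S₀ ∘L S₀.adjoint + S₁ ∘L S₁.adjoint = ContinuousLinearMap.id ℂ K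

namespace PModule

variable {H : Type*} [NormedAddCommGroup H] [InnerProductSpace ℂ H] [CompleteSpace H]

/-- The representation of the Cuntz algebra associated with a P-module:
`s_i ↦ τ_i*` on the large Hilbert space. -/
def cuntz (m : PModule H) : CuntzRep m.BigSpace where
  S₀ := (m.tau false).adjoint
  S₁ := (m.tau true).adjoint
  isometry₀ := by
    rw [ContinuousLinearMap.adjoint_adjoint, tau_adjoint_tau, if_pos rfl]
  isometry₁ := by
    rw [ContinuousLinearMap.adjoint_adjoint, tau_adjoint_tau, if_pos rfl]
  sum_ranges := by
    rw [ContinuousLinearMap.adjoint_adjoint, ContinuousLinearMap.adjoint_adjoint]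
    exact m.adjoint_tau_add

/-- `X` is a sub-module: a closed subspace that is stable under `A` and `B`. -/
def IsSubmodule (m : PModule H) (X : Submodule ℂ H) : Prop :=
  IsClosed (X : Set H) ∧ (∀ x ∈ X, m.A x ∈ X) ∧ ∀ x ∈ X, m.B x ∈ X

/-- `X` is a complete sub-module: a sub-module whose orthogonal complement is residual,
that is, contains no nonzero sub-module. -/
def IsCompleteSubmodule (m : PModule H) (X : Submodule ℂ H) : Prop :=
  m.IsSubmodule X ∧ ∀ Y : Submodule ℂ H, m.IsSubmodule Y → Y ≤ Xᗮ → Y = ⊥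

/-- A P-module is full if the residual complement of every complete sub-module is zero. -/
def IsFull (m : PModule H) : Prop :=
  ∀ X : Submodule ℂ H, m.IsCompleteSubmodule X → Xᗮ = ⊥

/-- A P-module is irreducible if it is nonzero and has no proper nonzero sub-module. -/
def IsIrreducible (m : PModule H) : Prop :=
  Nontrivial H ∧ ∀ X : Submodule ℂ H, m.IsSubmodule X → X = ⊥ ∨ X = ⊤

/-- The operator of the first `n` letters of an infinite binary word, read from right to
left: the first letter acts first. -/
def prefixOp (m : PModule H) (p : ℕ → Bool) : ℕ → H →L[ℂ] H
  | 0 => ContinuousLinearMap.id ℂ H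
  | n + 1 => m.op (p n) ∘L prefixOp m p n

/-- A P-module is diffuse if `p_n ξ → 0` for every vector `ξ` and every infinite word `p`. -/
def IsDiffuse (m : PModule H) : Prop :=
  ∀ (p : ℕ → Bool) (ξ : H), Filter.Tendsto (fun n => m.prefixOp p n ξ) Filter.atTop (nhds 0)

end PModule

namespace CuntzRep

universe u

variable {K : Type u} [NormedAddCommGroup K] [InnerProductSpace ℂ K] [CompleteSpace K]

/-- The P-module `(S₀*, S₁*, K)` given by a representation of the Cuntz algebra. -/
def toPModule (σ : CuntzRep K) : PModule K where
  A := σ.S₀.adjoint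
  B := σ.S₁.adjoint
  pythagorean := by
    rw [ContinuousLinearMap.adjoint_adjoint, ContinuousLinearMap.adjoint_adjoint]
    exact σ.sum_ranges

/-- Unitary equivalence of representations of the Cuntz algebra. (A unitary that intertwines
the generators also intertwines their adjoints.) -/
def UnitarilyEquiv {K' : Type*} [NormedAddCommGroup K'] [InnerProductSpace ℂ K']
    [CompleteSpace K'] (σ : CuntzRep K) (σ' : CuntzRep K') : Prop :=
  ∃ U : K ≃ₗᵢ[ℂ] K', (∀ x, U (σ.S₀ x) = σ'.S₀ (U x)) ∧ ∀ x, U (σ.S₁ x) = σ'.S₁ (U x)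

/-- A representation is irreducible if it is nonzero and no proper nonzero closed subspace is
stable under the generators and their adjoints. -/
def IsIrreducible (σ : CuntzRep K) : Prop :=
  Nontrivial K ∧ ∀ X : Submodule ℂ K, IsClosed (X : Set K) →
    (∀ x ∈ X, σ.S₀ x ∈ X ∧ σ.S₁ x ∈ X ∧ σ.S₀.adjoint x ∈ X ∧ σ.S₁.adjoint x ∈ X) →
    X = ⊥ ∨ X = ⊤

/-- The Pythagorean dimension: the minimal dimension, in `ℕ ∪ {∞}`, of a P-module whose
associated representation is unitarily equivalent to `σ`. -/
def pDim (σ : CuntzRep K) : ℕ∞ :=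
  sInf {d : ℕ∞ | ∃ (H : Type u) (_ : NormedAddCommGroup H) (_ : InnerProductSpace ℂ H)
    (_ : CompleteSpace H) (m : PModule H),
    m.cuntz.UnitarilyEquiv σ ∧ d = Cardinal.toENat (Module.rank ℂ H)}

end CuntzRep

end

/-!
The argument takes place in an arbitrary representation of the Cuntz algebra on a Hilbert space
`K`, with generating isometries `S i` and `T i = (S i)*`.

A closed subspace is stable under `T 0` and `T 1` iff its orthogonal complement is stable under
`S 0` and `S 1`. Hence a sub-module `X` of `(T 0, T 1, K)` is complete iff it generates `K`,
that is, iff the smallest closed `S`-stable subspace `gen X` containing it is everything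
(`isCompleteSubmodule_iff`). Moreover `gen X` is reducing (`T_mem_gen`).

The main point is that a complete sub-module `X` meets a finite dimensional complete sub-module
`F` in a complete sub-module (`isCompleteSubmodule_inf`). Since `F` generates `K`, a dense set of
vectors is moved into `F` by all sufficiently long words in `T 0, T 1`. If `L = gen (X ⊓ F)` were
not everything, some `x ∈ X` would have a nonzero component `b` in `Lᗮ`. The relation
`‖T 0 y‖² + ‖T 1 y‖² = ‖y‖²` and the pigeonhole principle yield words along which `x` approaches
`F`, without its component in `Lᗮ` becoming negligible. After normalization, compactness of the
balls of `F` produces a limit in `X ⊓ F ≤ L` of vectors at distance at least `1` from `L`, which is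
absurd. It follows that a complete sub-module of `F` of minimal dimension is contained in every
complete sub-module (`exists_isLeast_isCompleteSubmodule`).

The Pythagorean dimension is computed by a universal property (`cuntz_unitarilyEquiv`): when a
P-module is embedded in `K` as a generating sub-module, the summation of decorated trees identifies
its associated representation with `K`. So the P-modules of a representation are exactly its
complete sub-modules, and the smallest one has the least dimension (`pDim_eq`).

For a full P-module `H`, the smallest complete sub-module is complete in `H` too, so its complement
in `H` vanishes. In an irreducible representation every nonzero sub-module generates a nonzero
reducing subspace, hence is complete; this gives the last part.
-/

noncomputable section

/-! ### The Cuntz relations -/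

namespace CuntzRep

variable {K : Type*} [NormedAddCommGroup K] [InnerProductSpace ℂ K] [CompleteSpace K]
  (σ : CuntzRep K)

/-- The two generating isometries, indexed by a binary digit. -/
def S : Bool → K →L[ℂ] K
  | false => σ.S₀
  | true => σ.S₁

/-- The adjoints of the two generating isometries, indexed by a binary digit. -/
def T (i : Bool) : K →L[ℂ] K := (σ.S i).adjoint

theorem S_T_add (x : K) : σ.S false (σ.T false x) + σ.S true (σ.T true x) = x :=
  congrArg (fun f : K →L[ℂ] K => f x) σ.sum_ranges

theorem T_S_self (i : Bool) (x : K) : σ.T i (σ.S i x) = x := by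
  cases i
  · exact congrArg (fun f : K →L[ℂ] K => f x) σ.isometry₀
  · exact congrArg (fun f : K →L[ℂ] K => f x) σ.isometry₁

theorem T_S_not (i : Bool) (x : K) : σ.T i (σ.S (!i) x) = 0 := by
  have h := σ.S_T_add (σ.S (!i) x)
  rw [← σ.T_S_self i (σ.T i (σ.S (!i) x))]
  cases i <;> simp_all [T_S_self]

theorem T_S (i j : Bool) (x : K) : σ.T i (σ.S j x) = if i = j then x else 0 := by
  split_ifs with h
  · rw [h, T_S_self]
  · rw [show j = !i by cases i <;> cases j <;> simp_all, T_S_not]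

theorem inner_T_left (i : Bool) (x y : K) : inner ℂ (σ.T i x) y = inner ℂ x (σ.S i y) :=
  ContinuousLinearMap.adjoint_inner_left _ _ _

theorem inner_S_left (i : Bool) (x y : K) : inner ℂ (σ.S i x) y = inner ℂ x (σ.T i y) :=
  (ContinuousLinearMap.adjoint_inner_right _ _ _).symm

theorem inner_T_add (x y : K) : inner ℂ (σ.T false x) (σ.T false y) +
    inner ℂ (σ.T true x) (σ.T true y) = inner ℂ x y := by
  rw [inner_T_left, inner_T_left, ← inner_add_right, S_T_add]

theorem norm_T_sq_add (x : K) : ‖σ.T false x‖ ^ 2 + ‖σ.T true x‖ ^ 2 = ‖x‖ ^ 2 := by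
  have h := σ.inner_T_add x x
  simp only [inner_self_eq_norm_sq_to_K] at h
  exact_mod_cast h

theorem isSubmodule_iff (X : Submodule ℂ K) : σ.toPModule.IsSubmodule X ↔
    IsClosed (X : Set K) ∧ ∀ i, ∀ x ∈ X, σ.T i x ∈ X := by
  rw [Bool.forall_bool]; rfl

/-! ### Complete sub-modules are the generating ones -/

/-- The smallest closed subspace that contains `X` and is stable under the generating
isometries. -/
def gen (X : Submodule ℂ K) : Submodule ℂ K :=
  sInf {Z | IsClosed (Z : Set K) ∧ X ≤ Z ∧ ∀ i, ∀ x ∈ Z, σ.S i x ∈ Z}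

variable {σ}

theorem gen_le {X Z : Submodule ℂ K} (hZ : IsClosed (Z : Set K)) (h : X ≤ Z)
    (hS : ∀ i, ∀ x ∈ Z, σ.S i x ∈ Z) : σ.gen X ≤ Z :=
  sInf_le ⟨hZ, h, hS⟩

theorem le_gen (X : Submodule ℂ K) : X ≤ σ.gen X :=
  le_sInf fun _ h => h.2.1

theorem isClosed_gen (X : Submodule ℂ K) : IsClosed (σ.gen X : Set K) := by
  rw [gen, Submodule.coe_sInf]
  exact isClosed_biInter fun Z h => h.1

theorem S_mem_gen {X : Submodule ℂ K} (i : Bool) {x : K} (hx : x ∈ σ.gen X) :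
    σ.S i x ∈ σ.gen X :=
  Submodule.mem_sInf.2 fun Z h => h.2.2 i x (Submodule.mem_sInf.1 hx Z h)

/-- The subspace generated by a sub-module is reducing: the relations `T i (S j x) = x` or `0`
turn `{x ∈ gen X | T 0 x, T 1 x ∈ gen X}` into a competitor in the definition of `gen X`. -/
theorem T_mem_gen {X : Submodule ℂ K} (hX : ∀ i, ∀ x ∈ X, σ.T i x ∈ X) (i : Bool) {x : K}
    (hx : x ∈ σ.gen X) : σ.T i x ∈ σ.gen X := by
  let Z : Submodule ℂ K := σ.gen X ⊓ ⨅ i, (σ.gen X).comap (σ.T i).toLinearMap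
  have hmem : ∀ y, y ∈ Z ↔ y ∈ σ.gen X ∧ ∀ i, σ.T i y ∈ σ.gen X := fun y => by
    simp [Z, Submodule.mem_iInf]
  have h : σ.gen X ≤ Z := by
    refine gen_le ?_ (fun y hy => (hmem y).2 ⟨le_gen X hy, fun i => le_gen X (hX i y hy)⟩)
      fun j y hy => (hmem _).2 ⟨S_mem_gen j ((hmem y).1 hy).1, fun i => ?_⟩
    · have : (Z : Set K) = (σ.gen X : Set K) ∩ ⋂ i, σ.T i ⁻¹' (σ.gen X : Set K) := by
        ext y; simp [Z]
      rw [this]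
      exact (isClosed_gen X).inter
        (isClosed_iInter fun i => (isClosed_gen X).preimage (σ.T i).continuous)
    · rw [T_S]
      split_ifs
      · exact ((hmem y).1 hy).1
      · exact zero_mem _
  exact ((hmem x).1 (h hx)).2 i

theorem orthogonal_T_stable {Z : Submodule ℂ K} (hZ : ∀ i, ∀ x ∈ Z, σ.S i x ∈ Z) (i : Bool)
    {x : K} (hx : x ∈ Zᗮ) : σ.T i x ∈ Zᗮ := by
  rw [Submodule.mem_orthogonal'] at hx ⊢
  intro z hz
  rw [inner_T_left]
  exact hx _ (hZ i z hz)

theorem orthogonal_S_stable {Z : Submodule ℂ K} (hZ : ∀ i, ∀ x ∈ Z, σ.T i x ∈ Z) (i : Bool)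
    {x : K} (hx : x ∈ Zᗮ) : σ.S i x ∈ Zᗮ := by
  rw [Submodule.mem_orthogonal'] at hx ⊢
  intro z hz
  rw [inner_S_left]
  exact hx _ (hZ i z hz)

/-- A sub-module is complete iff it generates the whole representation. -/
theorem isCompleteSubmodule_iff {X : Submodule ℂ K} : σ.toPModule.IsCompleteSubmodule X ↔
    σ.toPModule.IsSubmodule X ∧ σ.gen X = ⊤ := by
  refine and_congr_right fun hX => ⟨fun h => ?_, fun h Y hY hYX => ?_⟩
  · have : CompleteSpace (σ.gen X) := (isClosed_gen X).completeSpace_coe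
    rw [← Submodule.orthogonal_eq_bot_iff]
    exact h _ ((σ.isSubmodule_iff _).2 ⟨Submodule.isClosed_orthogonal _,
      fun i x => orthogonal_T_stable (fun i x => S_mem_gen i) i⟩)
      (Submodule.orthogonal_le (le_gen X))
  · rw [isSubmodule_iff] at hY
    have h1 : σ.gen X ≤ Yᗮ := gen_le (Submodule.isClosed_orthogonal _)
      ((Submodule.le_orthogonal_orthogonal X).trans (Submodule.orthogonal_le hYX))
      fun i x => orthogonal_S_stable hY.2 i
    rw [h, top_le_iff] at h1
    have : CompleteSpace Y := hY.1.completeSpace_coe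
    exact (Submodule.orthogonal_eq_top_iff Y).1 h1

/-- In an irreducible representation every nonzero sub-module generates everything. -/
theorem IsIrreducible.isCompleteSubmodule (hσ : σ.IsIrreducible) {X : Submodule ℂ K}
    (hX : σ.toPModule.IsSubmodule X) (h0 : X ≠ ⊥) : σ.toPModule.IsCompleteSubmodule X := by
  have hT := ((σ.isSubmodule_iff X).1 hX).2
  have hgen := hσ.2 _ (isClosed_gen X) fun x hx =>
    ⟨S_mem_gen false hx, S_mem_gen true hx, T_mem_gen hT false hx, T_mem_gen hT true hx⟩
  exact isCompleteSubmodule_iff.2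
    ⟨hX, hgen.resolve_left fun h => h0 (le_bot_iff.1 (h ▸ le_gen X))⟩

/-! ### Intersecting with a finite dimensional complete sub-module -/

variable (σ) in
/-- The product of the operators `T i` along a finite binary word; the first letter acts
first. -/
def word : List Bool → K →L[ℂ] K
  | [] => ContinuousLinearMap.id ℂ K
  | i :: w => word w ∘L σ.T i

theorem word_mem {X : Submodule ℂ K} (hX : ∀ i, ∀ x ∈ X, σ.T i x ∈ X) :
    ∀ (w : List Bool) {x : K}, x ∈ X → σ.word w x ∈ X
  | [], _, hx => hx
  | i :: w, _, hx => word_mem hX w (hX i _ hx)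

/-- The squared norms of `T 0 x` and `T 1 x` add up to that of `x`, so a strict inequality
between quadratic expressions survives along some word of any prescribed length. -/
theorem exists_word_lt (α β : ℝ) : ∀ (n : ℕ) (x z b : K),
    α * ‖x‖ ^ 2 + β * ‖z‖ ^ 2 < ‖b‖ ^ 2 → ∃ w : List Bool, w.length = n ∧
      α * ‖σ.word w x‖ ^ 2 + β * ‖σ.word w z‖ ^ 2 < ‖σ.word w b‖ ^ 2
  | 0, _, _, _, h => ⟨[], rfl, h⟩
  | n + 1, x, z, b, h => by
    have key : ∃ i, α * ‖σ.T i x‖ ^ 2 + β * ‖σ.T i z‖ ^ 2 < ‖σ.T i b‖ ^ 2 := by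
      by_contra! hc
      have h0 := hc false
      have h1 := hc true
      rw [← σ.norm_T_sq_add x, ← σ.norm_T_sq_add z, ← σ.norm_T_sq_add b] at h
      linarith
    obtain ⟨i, hi⟩ := key
    obtain ⟨w, hw, h'⟩ := exists_word_lt α β n _ _ _ hi
    exact ⟨i :: w, by simp [hw], h'⟩

variable (σ) in
/-- The vectors that every sufficiently long word sends into `F`. -/
def eventuallyIn (F : Submodule ℂ K) : Submodule ℂ K where
  carrier := {y | ∃ N, ∀ w : List Bool, N ≤ w.length → σ.word w y ∈ F}
  zero_mem' := ⟨0, fun w _ => by simp⟩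
  add_mem' := by
    rintro x y ⟨N, hN⟩ ⟨M, hM⟩
    refine ⟨max N M, fun w hw => ?_⟩
    rw [map_add]
    exact F.add_mem (hN w ((le_max_left _ _).trans hw)) (hM w ((le_max_right _ _).trans hw))
  smul_mem' := by
    rintro c x ⟨N, hN⟩
    refine ⟨N, fun w hw => ?_⟩
    rw [map_smul]
    exact F.smul_mem c (hN w hw)

theorem dense_eventuallyIn {F : Submodule ℂ K} (hF : σ.toPModule.IsCompleteSubmodule F) :
    (σ.eventuallyIn F).topologicalClosure = ⊤ := by
  obtain ⟨hF, hgen⟩ := isCompleteSubmodule_iff.1 hF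
  rw [isSubmodule_iff] at hF
  rw [← top_le_iff, ← hgen]
  refine gen_le (Submodule.isClosed_topologicalClosure _)
    (le_trans (show F ≤ σ.eventuallyIn F from fun x hx => ⟨0, fun w _ => word_mem hF.2 w hx⟩)
      (Submodule.le_topologicalClosure _)) fun i x hx => ?_
  refine map_mem_closure (σ.S i).continuous hx fun y hy => ?_
  obtain ⟨N, hN⟩ := hy
  refine ⟨N + 1, fun w hw => ?_⟩
  cases w with
  | nil => simp at hw
  | cons j w =>
    have e : σ.word (j :: w) (σ.S i y) = σ.word w (σ.T j (σ.S i y)) := rfl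
    rw [e, T_S]
    split_ifs
    · exact hN w (by simpa using hw)
    · rw [map_zero]
      exact zero_mem F

/-- Given `x = a + b` with `a` in a reducing subspace `L` and `0 ≠ b ∈ Lᗮ`, some word moves `x`
arbitrarily close to `F` while the component in `Lᗮ` keeps norm `1` after normalization and the
norm stays bounded by a constant that depends on `x` and `b` only. -/
theorem exists_near {F X L : Submodule ℂ K} (hF : σ.toPModule.IsCompleteSubmodule F)
    (hX : ∀ i, ∀ x ∈ X, σ.T i x ∈ X) (hLT : ∀ i, ∀ x ∈ L, σ.T i x ∈ L)
    (hLS : ∀ i, ∀ x ∈ L, σ.S i x ∈ L) {x b : K} (hx : x ∈ X) (hab : x - b ∈ L)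
    (hb : b ∈ Lᗮ) (hb0 : b ≠ 0) {ε : ℝ} (hε : 0 < ε) :
    ∃ u ∈ X, ∃ v ∈ F, ∃ c ∈ Lᗮ, ‖c‖ = 1 ∧ u - c ∈ L ∧ ‖u - v‖ < ε ∧
      ‖b‖ ^ 2 * ‖u‖ ^ 2 ≤ 2 * (‖x‖ ^ 2 + 1) := by
  have hbn : 0 < ‖b‖ ^ 2 := by positivity
  have hxn : 0 < ‖x‖ ^ 2 + 1 := by positivity
  -- half of `‖b‖ ^ 2` pays for the norm bound, the other half for the distance to `F`
  set α : ℝ := ‖b‖ ^ 2 / (2 * (‖x‖ ^ 2 + 1)) with hα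
  have hαx : α * ‖x‖ ^ 2 < ‖b‖ ^ 2 / 2 := by
    rw [hα, div_mul_eq_mul_div, div_lt_div_iff₀ (by positivity) (by positivity)]
    nlinarith
  have hdense : x ∈ closure (σ.eventuallyIn F : Set K) := by
    rw [← Submodule.topologicalClosure_coe, dense_eventuallyIn hF]
    trivial
  obtain ⟨y, ⟨N, hN⟩, hy⟩ := Metric.mem_closure_iff.1 hdense (ε * ‖b‖ / 2) (by positivity)
  rw [dist_eq_norm] at hy
  have hz : (1 / ε ^ 2) * ‖x - y‖ ^ 2 ≤ ‖b‖ ^ 2 / 2 := by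
    rw [one_div_mul_eq_div, div_le_iff₀ (by positivity)]
    have h1 : ‖x - y‖ ^ 2 ≤ (ε * ‖b‖ / 2) ^ 2 := by gcongr
    nlinarith [mul_pos (pow_pos hε 2) hbn]
  obtain ⟨w, hw, h⟩ := exists_word_lt (σ := σ) α (1 / ε ^ 2) N x (x - y) b (by linarith)
  have hα0 : 0 < α := by positivity
  have hc0 : 0 < ‖σ.word w b‖ := by
    have : 0 < ‖σ.word w b‖ ^ 2 := lt_of_le_of_lt (by positivity) h
    exact lt_of_le_of_ne (norm_nonneg _) fun h0 => by simp [← h0] at this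
  set r : ℝ := ‖σ.word w b‖ with hr
  have hrc : ‖((r⁻¹ : ℝ) : ℂ)‖ = r⁻¹ := by
    rw [Complex.norm_real, Real.norm_of_nonneg (by positivity)]
  refine ⟨((r⁻¹ : ℝ) : ℂ) • σ.word w x, X.smul_mem _ (word_mem hX w hx),
    ((r⁻¹ : ℝ) : ℂ) • σ.word w y, F.smul_mem _ (hN w hw.ge),
    ((r⁻¹ : ℝ) : ℂ) • σ.word w b,
    Submodule.smul_mem _ _ (word_mem (fun i x => orthogonal_T_stable hLS i) w hb), ?_, ?_, ?_, ?_⟩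
  · rw [norm_smul, hrc, ← hr, inv_mul_cancel₀ hc0.ne']
  · rw [← smul_sub, ← map_sub]
    exact L.smul_mem _ (word_mem hLT w hab)
  · rw [← smul_sub, ← map_sub, norm_smul, hrc, inv_mul_lt_iff₀ hc0]
    have h1 : 1 / ε ^ 2 * ‖σ.word w (x - y)‖ ^ 2 < r ^ 2 :=
      lt_of_le_of_lt (le_add_of_nonneg_left (by positivity)) h
    rw [one_div_mul_eq_div, div_lt_iff₀ (by positivity), ← mul_pow] at h1
    exact lt_of_pow_lt_pow_left₀ 2 (by positivity) h1
  · have h1 : α * ‖σ.word w x‖ ^ 2 < r ^ 2 :=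
      lt_of_le_of_lt (le_add_of_nonneg_right (by positivity)) h
    rw [hα, div_mul_eq_mul_div, div_lt_iff₀ (by positivity)] at h1
    rw [norm_smul, hrc, mul_pow, inv_pow, mul_left_comm, inv_mul_le_iff₀ (by positivity)]
    exact h1.le

/-- A complete sub-module meets a finite dimensional complete sub-module in a complete
sub-module. Otherwise the reducing subspace `L` generated by the intersection misses a vector of
`X`; translates of that vector approach `F`, and by compactness they accumulate at a vector of
`X ⊓ F ≤ L`, although their distance to `L` is bounded below. -/
theorem isCompleteSubmodule_inf {F X : Submodule ℂ K} [FiniteDimensional ℂ F]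
    (hF : σ.toPModule.IsCompleteSubmodule F) (hX : σ.toPModule.IsCompleteSubmodule X) :
    σ.toPModule.IsCompleteSubmodule (X ⊓ F) := by
  obtain ⟨hXc, hXT⟩ := (σ.isSubmodule_iff X).1 hX.1
  obtain ⟨hFc, hFT⟩ := (σ.isSubmodule_iff F).1 hF.1
  have hT : ∀ i, ∀ x ∈ X ⊓ F, σ.T i x ∈ X ⊓ F := fun i x hx => ⟨hXT i x hx.1, hFT i x hx.2⟩
  refine isCompleteSubmodule_iff.2 ⟨(σ.isSubmodule_iff _).2 ⟨hXc.inter hFc, hT⟩, ?_⟩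
  by_contra hL
  have : CompleteSpace (σ.gen (X ⊓ F)) := (isClosed_gen _).completeSpace_coe
  obtain ⟨x, hx, hxL⟩ : ∃ x ∈ X, x ∉ σ.gen (X ⊓ F) := by
    by_contra! h
    refine hL (top_le_iff.1 ?_)
    rw [← (isCompleteSubmodule_iff.1 hX).2]
    exact gen_le (isClosed_gen _) h fun i x => S_mem_gen i
  obtain ⟨a, ha, b, hb, rfl⟩ := (σ.gen (X ⊓ F)).exists_add_mem_mem_orthogonal x
  have hb0 : b ≠ 0 := by
    rintro rfl
    exact hxL (by simpa using ha)
  have key : ∀ n : ℕ, _ := fun n : ℕ =>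
    exists_near hF hXT (fun i x => T_mem_gen hT i) (fun i x => S_mem_gen i) hx
      (by simpa using ha) hb hb0 (Nat.one_div_pos_of_nat (α := ℝ) (n := n))
  choose u hu v hv c hc hc1 huc huv hun using key
  -- the sequence `v` stays in a ball of the finite dimensional space `F`
  obtain ⟨R, hR⟩ : ∃ R : ℝ, ∀ n, ‖v n‖ ≤ R := by
    refine ⟨2 * (‖a + b‖ ^ 2 + 1) / ‖b‖ ^ 2 + 1 + 1, fun n => ?_⟩
    have h1 : ‖u n‖ ^ 2 ≤ 2 * (‖a + b‖ ^ 2 + 1) / ‖b‖ ^ 2 := by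
      rw [le_div_iff₀ (by positivity)]
      linarith [hun n]
    have h2 : ‖v n‖ ≤ ‖u n‖ + ‖u n - v n‖ := by
      simpa using norm_sub_le (u n) (u n - v n)
    have h3 : (1 : ℝ) / (n + 1) ≤ 1 := by
      rw [div_le_one (by positivity)]
      linarith [(Nat.cast_nonneg n : (0 : ℝ) ≤ n)]
    nlinarith [huv n, sq_nonneg (‖u n‖ - 1)]
  have : ProperSpace F := FiniteDimensional.proper ℂ F
  obtain ⟨v', -, φ, hφ, hlim⟩ := (isCompact_closedBall (0 : F) R).tendsto_subseq
    (x := fun n => (⟨v n, hv n⟩ : F)) fun n => by simpa using hR n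
  have hlim' : Filter.Tendsto (fun n => v (φ n)) Filter.atTop (nhds (v' : K)) :=
    (continuous_subtype_val.tendsto v').comp hlim
  have hd : Filter.Tendsto (fun n => u (φ n) - v (φ n)) Filter.atTop (nhds 0) :=
    (squeeze_zero_norm (fun n => (huv n).le) tendsto_one_div_add_atTop_nhds_zero_nat).comp
      hφ.tendsto_atTop
  have hu' : Filter.Tendsto (fun n => u (φ n)) Filter.atTop (nhds (v' : K)) := by
    simpa using hd.add hlim'
  have hv'L : (v' : K) ∈ σ.gen (X ⊓ F) :=
    le_gen _ ⟨hXc.mem_of_tendsto hu' (Filter.Eventually.of_forall fun n => hu (φ n)), v'.2⟩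
  -- `c n` is a unit vector orthogonal to `gen (X ⊓ F)`, which bounds the distance below
  have hlow : ∀ n, 1 ≤ ‖u n - v'‖ := fun n => by
    have h1 : inner ℂ (c n) (u n - v') = inner ℂ (c n) (c n) := by
      have h2 : inner ℂ (c n) ((u n - c n) - v') = 0 :=
        (Submodule.mem_orthogonal' _ _).1 (hc n) _ (Submodule.sub_mem _ (huc n) hv'L)
      rw [show u n - v' = c n + ((u n - c n) - v') by abel, inner_add_right, h2, add_zero]
    have h3 := norm_inner_le_norm (𝕜 := ℂ) (c n) (u n - v')
    rw [h1, inner_self_eq_norm_sq_to_K, hc1] at h3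
    simpa using h3
  have h0 : Filter.Tendsto (fun n => ‖u (φ n) - v'‖) Filter.atTop (nhds 0) := by
    have := (hu'.sub_const (v' : K)).norm
    simpa using this
  exact absurd (ge_of_tendsto h0 (Filter.Eventually.of_forall fun n => hlow (φ n))) (by norm_num)

/-- Below a finite dimensional complete sub-module `F` lies a smallest complete sub-module:
a complete sub-module of `F` of minimal dimension. -/
theorem exists_isLeast_isCompleteSubmodule {F : Submodule ℂ K} [FiniteDimensional ℂ F]
    (hF : σ.toPModule.IsCompleteSubmodule F) :
    ∃ M, IsLeast {X | σ.toPModule.IsCompleteSubmodule X} M := by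
  let P : ℕ → Prop := fun d => ∃ M : Submodule ℂ K,
    σ.toPModule.IsCompleteSubmodule M ∧ FiniteDimensional ℂ M ∧ Module.finrank ℂ M = d
  have hP : ∃ d, P d := ⟨_, F, hF, ‹_›, rfl⟩
  classical
  obtain ⟨M, hM, hfin, hd⟩ := Nat.find_spec hP
  refine ⟨M, hM, fun X hX => ?_⟩
  have hfin' : FiniteDimensional ℂ (X ⊓ M : Submodule ℂ K) :=
    Submodule.finiteDimensional_of_le inf_le_right
  have h1 : Nat.find hP ≤ Module.finrank ℂ (X ⊓ M : Submodule ℂ K) :=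
    Nat.find_min' hP ⟨_, isCompleteSubmodule_inf hM hX, hfin', rfl⟩
  have h2 : X ⊓ M = M := Submodule.eq_of_le_of_finrank_le inf_le_right (hd ▸ h1)
  exact inf_eq_right.1 h2

end CuntzRep

/-! ### The universal property of the associated representation -/

namespace PModule

open BTree

section TreeFun

variable {H : Type*} [NormedAddCommGroup H] [InnerProductSpace ℂ H]
  {K : Type*} [NormedAddCommGroup K] [InnerProductSpace ℂ K] [CompleteSpace K]
  (σ : CuntzRep K) (V : H →ₗᵢ[ℂ] K)

/-- The vector of `K` that a decorated tree represents, once the decorations are sent to `K` by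
`V`: the sum over the leaves `ℓ` of `S_ℓ (V ξ_ℓ)`, with `S_ℓ` the product of the generating
isometries along the path from the root to `ℓ`. -/
def treeFun : ∀ t : BTree, (Leaf t → H) → K
  | leaf, ξ => V (ξ ())
  | node l r, ξ => σ.S false (treeFun l fun i => ξ (Sum.inl i)) +
      σ.S true (treeFun r fun i => ξ (Sum.inr i))

theorem treeFun_add : ∀ (t : BTree) (ξ η : Leaf t → H),
    treeFun σ V t (ξ + η) = treeFun σ V t ξ + treeFun σ V t η
  | leaf, ξ, η => map_add V (ξ ()) (η ())
  | node l r, ξ, η => by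
    have h1 := treeFun_add l (fun i => ξ (Sum.inl i)) fun i => η (Sum.inl i)
    have h2 := treeFun_add r (fun i => ξ (Sum.inr i)) fun i => η (Sum.inr i)
    simp only [treeFun]
    rw [add_add_add_comm, ← map_add, ← map_add, ← h1, ← h2]
    rfl

theorem treeFun_smul : ∀ (t : BTree) (c : ℂ) (ξ : Leaf t → H),
    treeFun σ V t (c • ξ) = c • treeFun σ V t ξ
  | leaf, c, ξ => map_smul V c (ξ ())
  | node l r, c, ξ => by
    have h1 := treeFun_smul l c fun i => ξ (Sum.inl i)
    have h2 := treeFun_smul r c fun i => ξ (Sum.inr i)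
    simp only [treeFun]
    rw [smul_add, ← map_smul, ← map_smul, ← h1, ← h2]
    rfl

theorem inner_treeFun : ∀ (t : BTree) (ξ η : Leaf t → H),
    inner ℂ (treeFun σ V t ξ) (treeFun σ V t η) = leafInner t ξ η
  | leaf, ξ, η => by
    rw [leafInner_leaf]
    exact V.inner_map_map _ _
  | node l r, ξ, η => by
    rw [leafInner_node, ← inner_treeFun l, ← inner_treeFun r]
    simp only [treeFun]
    rw [← σ.inner_T_add]
    simp [CuntzRep.T_S]

end TreeFun

variable {H : Type*} [NormedAddCommGroup H] [InnerProductSpace ℂ H] [CompleteSpace H]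
  (m : PModule H)

theorem cuntz_S_coe (i : Bool) (x : m.Pre) :
    m.cuntz.S i (x : m.BigSpace) = ((m.plant i x : m.Pre) : m.BigSpace) := by
  cases i
  · exact m.adjoint_tau_coe false x
  · exact m.adjoint_tau_coe true x

theorem cuntz_T (i : Bool) : m.cuntz.T i = m.tau i := by
  cases i
  · exact ContinuousLinearMap.adjoint_adjoint _
  · exact ContinuousLinearMap.adjoint_adjoint _

theorem cuntz_T_embed (i : Bool) (x : H) : m.cuntz.T i (m.embed x) = m.embed (m.op i x) := by
  rw [cuntz_T, tau_embed]

theorem isSubmodule_iff (X : Submodule ℂ H) : m.IsSubmodule X ↔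
    IsClosed (X : Set H) ∧ ∀ i, ∀ x ∈ X, m.op i x ∈ X := by
  rw [Bool.forall_bool]; rfl

section TreeMap

variable {K : Type*} [NormedAddCommGroup K] [InnerProductSpace ℂ K] [CompleteSpace K]
  {σ : CuntzRep K} {V : H →ₗᵢ[ℂ] K}

variable {m}

theorem treeFun_growFun (hV : ∀ i x, σ.T i (V x) = V (m.op i x)) :
    ∀ (t s : BTree), t ≤ s → ∀ ξ : Leaf t → H,
      treeFun σ V t ξ = treeFun σ V s (m.growFun t s ξ)
  | leaf, leaf, _, _ => rfl
  | node _ _, leaf, h, _ => h.elim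
  | leaf, node l r, _, ξ => by
    have h1 := treeFun_growFun hV leaf l trivial fun u => m.A (ξ u)
    have h2 := treeFun_growFun hV leaf r trivial fun u => m.B (ξ u)
    have e1 : σ.T false (V (ξ ())) = V (m.A (ξ ())) := hV false _
    have e2 : σ.T true (V (ξ ())) = V (m.B (ξ ())) := hV true _
    refine (σ.S_T_add (V (ξ ()))).symm.trans ?_
    rw [e1, e2]
    exact congrArg₂ (fun x y => σ.S false x + σ.S true y) h1 h2
  | node l r, node l' r', h, ξ => by
    have h1 := treeFun_growFun hV l l' h.1 fun i => ξ (Sum.inl i)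
    have h2 := treeFun_growFun hV r r' h.2 fun i => ξ (Sum.inr i)
    exact congrArg₂ (fun x y => σ.S false x + σ.S true y) h1 h2

/-- `treeFun` on the direct limit. -/
def treeMap (hV : ∀ i x, σ.T i (V x) = V (m.op i x)) : m.Pre →ₗᵢ[ℂ] K :=
  LinearMap.isometryOfInner
    { toFun := fun x => DirectLimit.lift m.grow (treeFun σ V) (treeFun_growFun hV) x
      map_add' := m.ind₂ fun t ξ η => by
        rw [← cls_add]
        exact treeFun_add σ V t ξ η
      map_smul' := fun c => m.ind fun t ξ => by
        rw [← cls_smul]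
        exact treeFun_smul σ V t c ξ }
    (m.ind₂ fun t ξ η => by
      rw [inner_cls]
      exact inner_treeFun σ V t ξ η)

theorem treeMap_plant (hV : ∀ i x, σ.T i (V x) = V (m.op i x)) (i : Bool) :
    ∀ x, treeMap hV (m.plant i x) = σ.S i (treeMap hV x) := by
  refine m.ind fun t ξ => ?_
  cases i
  · have h : treeMap hV (m.plant false (m.cls t ξ)) =
        σ.S false (treeFun σ V t ξ) + σ.S true (V 0) := rfl
    rw [h, map_zero, map_zero, add_zero]
    rfl
  · have h : treeMap hV (m.plant true (m.cls t ξ)) =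
        σ.S false (V 0) + σ.S true (treeFun σ V t ξ) := rfl
    rw [h, map_zero, map_zero, zero_add]
    rfl

/-- The isometry of the large Hilbert space into `K` that extends `V`. -/
def lift (hV : ∀ i x, σ.T i (V x) = V (m.op i x)) : m.BigSpace →ₗᵢ[ℂ] K where
  toLinearMap := ((treeMap hV).toContinuousLinearMap.extend
    (UniformSpace.Completion.toComplL (𝕜 := ℂ) (E := m.Pre))).toLinearMap
  norm_map' x := by
    refine UniformSpace.Completion.induction_on x
      (isClosed_eq (ContinuousLinearMap.continuous _).norm continuous_norm) fun a => ?_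
    rw [UniformSpace.Completion.norm_coe, ← (treeMap hV).norm_map a]
    exact congrArg norm (ContinuousLinearMap.extend_eq _
      UniformSpace.Completion.denseRange_coe
      (UniformSpace.Completion.isUniformInducing_coe _) a)

theorem lift_coe (hV : ∀ i x, σ.T i (V x) = V (m.op i x)) (x : m.Pre) :
    lift hV (x : m.BigSpace) = treeMap hV x :=
  ContinuousLinearMap.extend_eq _ UniformSpace.Completion.denseRange_coe
    (UniformSpace.Completion.isUniformInducing_coe _) x

theorem lift_embed (hV : ∀ i x, σ.T i (V x) = V (m.op i x)) (x : H) :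
    lift hV (m.embed x) = V x :=
  lift_coe hV _

theorem lift_S (hV : ∀ i x, σ.T i (V x) = V (m.op i x)) (i : Bool) (x : m.BigSpace) :
    lift hV (m.cuntz.S i x) = σ.S i (lift hV x) := by
  refine UniformSpace.Completion.induction_on x
    (isClosed_eq (by fun_prop) (by fun_prop)) fun a => ?_
  rw [cuntz_S_coe, lift_coe, lift_coe, treeMap_plant]

/-- A P-module is embedded in a representation as a generating sub-module only if the
representation is the one associated with the P-module. -/
theorem cuntz_unitarilyEquiv (hV : ∀ i x, σ.T i (V x) = V (m.op i x))
    (hgen : σ.gen (LinearMap.range V.toLinearMap) = ⊤) : m.cuntz.UnitarilyEquiv σ := by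
  have hsurj : Function.Surjective (lift hV) := by
    rw [← LinearIsometry.coe_toLinearMap, ← LinearMap.range_eq_top, ← top_le_iff, ← hgen]
    refine CuntzRep.gen_le ?_ ?_ ?_
    · exact (lift hV).isometry.isClosedEmbedding.isClosed_range
    · rintro _ ⟨x, rfl⟩
      exact ⟨m.embed x, lift_embed hV x⟩
    · rintro i _ ⟨x, rfl⟩
      exact ⟨m.cuntz.S i x, lift_S hV i x⟩
  exact ⟨LinearIsometryEquiv.ofSurjective (lift hV) hsurj, lift_S hV false, lift_S hV true⟩

end TreeMap

/-- The decorations of the trivial tree generate the large Hilbert space. -/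
theorem isCompleteSubmodule_range_embed :
    m.cuntz.toPModule.IsCompleteSubmodule (LinearMap.range m.embed.toLinearMap) := by
  refine CuntzRep.isCompleteSubmodule_iff.2 ⟨(m.cuntz.isSubmodule_iff _).2 ⟨?_, ?_⟩, ?_⟩
  · exact m.embed.isometry.isClosedEmbedding.isClosed_range
  · rintro i _ ⟨x, rfl⟩
    exact ⟨m.op i x, (m.cuntz_T_embed i x).symm⟩
  set G := m.cuntz.gen (LinearMap.range m.embed.toLinearMap) with hG
  have hcls : ∀ (t : BTree) (ξ : Leaf t → H), (m.cls t ξ : m.BigSpace) ∈ G := by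
    intro t
    induction t with
    | leaf => exact fun ξ => CuntzRep.le_gen _ ⟨ξ (), rfl⟩
    | node l r hl hr =>
      intro ξ
      have h := m.cuntz.S_T_add (m.cls (node l r) ξ : m.BigSpace)
      rw [cuntz_T, cuntz_T, tau_coe, tau_coe] at h
      rw [← h]
      exact G.add_mem (CuntzRep.S_mem_gen _ (hl _)) (CuntzRep.S_mem_gen _ (hr _))
  refine top_le_iff.1 fun x _ => ?_
  exact UniformSpace.Completion.induction_on x (CuntzRep.isClosed_gen _) (m.ind hcls)

end PModule

namespace CuntzRep

open PModule

universe u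

variable {K : Type u} [NormedAddCommGroup K] [InnerProductSpace ℂ K] [CompleteSpace K]
  {σ : CuntzRep K}

/-! ### The Pythagorean dimension -/

/-- Complete sub-modules are carried along a unitary equivalence. -/
theorem isCompleteSubmodule_map {K' : Type*} [NormedAddCommGroup K'] [InnerProductSpace ℂ K']
    [CompleteSpace K'] {σ' : CuntzRep K'} (U : K' ≃ₗᵢ[ℂ] K)
    (hU : ∀ i x, U (σ'.S i x) = σ.S i (U x)) {X : Submodule ℂ K'}
    (hX : σ'.toPModule.IsCompleteSubmodule X) :
    σ.toPModule.IsCompleteSubmodule (X.map U.toLinearEquiv.toLinearMap) := by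
  obtain ⟨hX, hgen⟩ := isCompleteSubmodule_iff.1 hX
  rw [isSubmodule_iff] at hX
  have hUT : ∀ i x, σ.T i (U x) = U (σ'.T i x) := fun i x => by
    rw [← σ'.S_T_add x, map_add, hU, hU, map_add, map_add, map_add, T_S, T_S, T_S, T_S]
    cases i <;> simp
  refine isCompleteSubmodule_iff.2 ⟨(isSubmodule_iff _ _).2 ⟨?_, ?_⟩, ?_⟩
  · exact U.toHomeomorph.isClosedMap _ hX.1
  · rintro i _ ⟨x, hx, rfl⟩
    exact ⟨σ'.T i x, hX.2 i x hx, (hUT i x).symm⟩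
  have h : σ'.gen X ≤ (σ.gen (X.map U.toLinearEquiv.toLinearMap)).comap
      U.toLinearEquiv.toLinearMap := by
    refine gen_le ((isClosed_gen _).preimage U.continuous)
      (fun x hx => le_gen _ ⟨x, hx, rfl⟩) fun i x hx => ?_
    have hx' : U x ∈ σ.gen (X.map U.toLinearEquiv.toLinearMap) := hx
    have : U (σ'.S i x) ∈ σ.gen (X.map U.toLinearEquiv.toLinearMap) := by
      rw [hU]
      exact S_mem_gen i hx'
    exact this
  rw [hgen] at h
  refine top_le_iff.1 fun y _ => ?_
  have := h (Submodule.mem_top (x := U.symm y))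
  simpa using this

/-- A sub-module of a representation, as a P-module in its own right. -/
def restrict (X : Submodule ℂ K) [CompleteSpace X] (hX : ∀ i, ∀ x ∈ X, σ.T i x ∈ X) :
    PModule X where
  A := ((σ.T false) ∘L X.subtypeL).codRestrict X fun x => hX false x x.2
  B := ((σ.T true) ∘L X.subtypeL).codRestrict X fun x => hX true x x.2
  pythagorean := by
    refine ContinuousLinearMap.ext fun x => ext_inner_right ℂ fun y => ?_
    simp only [add_apply, ContinuousLinearMap.comp_apply, inner_add_left,
      ContinuousLinearMap.adjoint_inner_left, ContinuousLinearMap.id_apply]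
    exact σ.inner_T_add (x : K) y

/-- The Pythagorean dimension is attained at the smallest complete sub-module: that sub-module is
a P-module whose associated representation is `σ`, and every other such P-module is embedded as
a complete sub-module, hence contains it. -/
theorem pDim_eq {M : Submodule ℂ K} (hM : IsLeast {X | σ.toPModule.IsCompleteSubmodule X} M) :
    σ.pDim = Cardinal.toENat (Module.rank ℂ M) := by
  obtain ⟨hMs, hgen⟩ := isCompleteSubmodule_iff.1 hM.1
  rw [isSubmodule_iff] at hMs
  have hc : CompleteSpace M := hMs.1.completeSpace_coe
  refine le_antisymm (sInf_le ⟨M, inferInstance, inferInstance, hc, restrict M hMs.2, ?_, rfl⟩)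
    (le_sInf ?_)
  · refine cuntz_unitarilyEquiv (V := M.subtypeₗᵢ) (fun i x => by cases i <;> rfl) ?_
    rw [Submodule.subtypeₗᵢ_toLinearMap, Submodule.range_subtype, hgen]
  · rintro _ ⟨H, _, _, _, m, ⟨U, hU₀, hU₁⟩, rfl⟩
    have h := hM.2 (isCompleteSubmodule_map U (σ' := m.cuntz) (σ := σ)
      (fun i => by cases i; exacts [hU₀, hU₁]) m.isCompleteSubmodule_range_embed)
    rw [← LinearMap.range_comp] at h
    exact OrderHomClass.mono Cardinal.toENat
      ((Submodule.rank_mono h).trans (rank_range_le _))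

end CuntzRep

/-! ### Sub-modules of the associated representation inside the P-module -/

namespace PModule

variable {H : Type*} [NormedAddCommGroup H] [InnerProductSpace ℂ H] [CompleteSpace H]
  {m : PModule H}

theorem isSubmodule_comap_embed {X : Submodule ℂ m.BigSpace}
    (hX : m.cuntz.toPModule.IsSubmodule X) :
    m.IsSubmodule (X.comap m.embed.toLinearMap) := by
  rw [CuntzRep.isSubmodule_iff] at hX
  refine (m.isSubmodule_iff _).2 ⟨hX.1.preimage m.embed.continuous, fun i x hx => ?_⟩
  have : m.embed (m.op i x) ∈ X := by
    rw [← cuntz_T_embed]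
    exact hX.2 i _ hx
  exact this

theorem isCompleteSubmodule_comap_embed {X : Submodule ℂ m.BigSpace}
    (hX : m.cuntz.toPModule.IsCompleteSubmodule X)
    (hle : X ≤ LinearMap.range m.embed.toLinearMap) :
    m.IsCompleteSubmodule (X.comap m.embed.toLinearMap) := by
  refine ⟨isSubmodule_comap_embed hX.1, fun Y hY hYX => ?_⟩
  rw [isSubmodule_iff] at hY
  have h := hX.2 (Y.map m.embed.toLinearMap) ((m.cuntz.isSubmodule_iff _).2 ⟨?_, ?_⟩) ?_
  · refine (Submodule.eq_bot_iff _).2 fun y hy => ?_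
    have hy0 : m.embed y ∈ Y.map m.embed.toLinearMap := ⟨y, hy, rfl⟩
    rw [h, Submodule.mem_bot] at hy0
    exact m.embed.injective (hy0.trans (map_zero _).symm)
  · exact m.embed.isometry.isClosedEmbedding.isClosedMap _ hY.1
  · rintro i _ ⟨x, hx, rfl⟩
    exact ⟨m.op i x, hY.2 i x hx, (m.cuntz_T_embed i x).symm⟩
  · rintro _ ⟨y, hy, rfl⟩
    refine (Submodule.mem_orthogonal' _ _).2 fun z hz => ?_
    obtain ⟨x, rfl⟩ := hle hz
    exact (m.embed.inner_map_map y x).trans ((Submodule.mem_orthogonal' _ _).1 (hYX hy) x hz)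

end PModule

end

theorem theoremA {H : Type*} [NormedAddCommGroup H] [InnerProductSpace ℂ H]
    [CompleteSpace H] [FiniteDimensional ℂ H] (m : PModule H) :
    -- `(S₀*, S₁*, 𝓗)` is a P-module that contains the P-module `H`
    ((∀ x : H, m.cuntz.toPModule.A (m.embed x) = m.embed (m.A x)) ∧
      ∀ x : H, m.cuntz.toPModule.B (m.embed x) = m.embed (m.B x)) ∧
    ∃ Hsmall : Submodule ℂ m.BigSpace,
      -- the smallest complete sub-module exists, is the intersection of all of them, and
      -- lies inside `H`
      Hsmall = sInf {X : Submodule ℂ m.BigSpace | m.cuntz.toPModule.IsCompleteSubmodule X} ∧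
      IsLeast {X : Submodule ℂ m.BigSpace | m.cuntz.toPModule.IsCompleteSubmodule X} Hsmall ∧
      Hsmall ≤ LinearMap.range m.embed.toLinearMap ∧
      -- its dimension is the Pythagorean dimension
      m.cuntz.pDim = Cardinal.toENat (Module.rank ℂ Hsmall) ∧
      -- the case of a full P-module
      (m.IsFull → LinearMap.range m.embed.toLinearMap = Hsmall ∧
        m.cuntz.pDim = Cardinal.toENat (Module.rank ℂ H)) ∧
      -- the irreducible diffuse case
      (m.IsDiffuse → m.cuntz.IsIrreducible →
        Hsmall ≠ ⊥ ∧
        (∀ X : Submodule ℂ m.BigSpace,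
          m.cuntz.toPModule.IsSubmodule X → X ≠ ⊥ → Hsmall ≤ X) ∧
        (m.IsIrreducible → LinearMap.range m.embed.toLinearMap = Hsmall)) := by
  refine ⟨⟨m.cuntz_T_embed false, m.cuntz_T_embed true⟩, ?_⟩
  have hF := m.isCompleteSubmodule_range_embed
  obtain ⟨M, hM⟩ := CuntzRep.exists_isLeast_isCompleteSubmodule hF
  have hMF : M ≤ LinearMap.range m.embed.toLinearMap := hM.2 hF
  have hfull : M.comap m.embed.toLinearMap = ⊤ → LinearMap.range m.embed.toLinearMap = M :=
    fun h => le_antisymm (LinearMap.range_le_iff_comap.2 h) hMF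
  refine ⟨M, hM.isGLB.sInf_eq.symm, hM, hMF, CuntzRep.pDim_eq hM, fun h => ?_, fun _ hirr => ?_⟩
  · have hX := PModule.isCompleteSubmodule_comap_embed hM.1 hMF
    have : CompleteSpace (M.comap m.embed.toLinearMap) := hX.1.1.completeSpace_coe
    have hr := hfull ((Submodule.orthogonal_eq_bot_iff).1 (h _ hX))
    refine ⟨hr, ?_⟩
    rw [CuntzRep.pDim_eq hM, ← hr, rank_range_of_injective _ m.embed.injective]
  · have hne : M ≠ ⊥ := by
      rintro rfl
      have := hirr.1
      -- every subspace is orthogonal to `⊥`, so `⊥` is complete only in the zero space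
      have h := hM.1.2 ⊤ ((CuntzRep.isSubmodule_iff _ _).2 ⟨isClosed_univ, fun _ _ _ => trivial⟩)
        (by rw [Submodule.bot_orthogonal_eq_top])
      exact top_ne_bot h
    refine ⟨hne, fun X hX h0 => hM.2 (hirr.isCompleteSubmodule hX h0), fun hm => hfull ?_⟩
    refine (hm.2 _ (PModule.isSubmodule_comap_embed hM.1.1)).resolve_left fun h => hne ?_
    refine (Submodule.eq_bot_iff _).2 fun x hx => ?_
    obtain ⟨y, rfl⟩ := hMF hx
    have hy : y ∈ M.comap m.embed.toLinearMap := hx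
    rw [h, Submodule.mem_bot] at hy
    rw [hy, map_zero]
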